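/- Let $n\ge 1$. For a prime $p$ and $C\in \mathrm{GL}_n(\mathbb F_p)$, let $\tilde g_{p,C}:\mathrm{GL}_n(\mathbb F_p)\to[0,1]^{2n^2}$ be the map $A\mapsto (A/p,\,B/p)$, where $B=CA^{-1}$ is the solution of $BA=C$, and where $A/p$ denotes the array of the numbers $a_{ij}/p$ with $a_{ij}\in\{0,\dots,p-1\}$ the representatives of the entries of $A$ (similarly $B/p$). Let $R\subseteq[0,1]^{2n^2}$ be a (Lebesgue) measurable set with the following property: for every $\epsilon>0$ there exist two finite collections of non-overlapping rectangles (axis-parallel boxes) $R_1,\dots,R_k$ and $R^1,\dots,R^l$ such that $\bigcup_{i=1}^k R_i\subseteq R\subseteq\bigcup_{j=1}^l R^j$, $\mathrm{area}\big(R\setminus\bigcup_i R_i\big)<\epsilon$ and $\mathrm{area}\big(\bigcup_j R^j\setminus R\big)<\epsilon$, where area denotes Lebesgue measure in $\mathbb R^{2n^2}$. Then, for every choice of matrices $C_p\in\mathrm{GL}_n(\mathbb F_p)$, one for each prime $p$, $$\lim_{\substack{p\to\infty\\ p\ \mathrm{prime}}}\frac{\#\big(\mathrm{Image}(\tilde g_{p,C_p})\cap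 R\big)}{\#\mathrm{GL}_n(\mathbb F_p)}=\mathrm{area}(R).$$ -/

import Mathlib

open Filter Topology MeasureTheory

/-- An axis-parallel rectangle in `ℝ^ι`: a product of bounded intervals
(open, closed or half-open). -/
def IsRectangle {ι : Type*} (S : Set (ι → ℝ)) : Prop :=
  ∃ I : ι → Set ℝ, (∀ i, (I i).OrdConnected ∧ Bornology.IsBounded (I i)) ∧ S = Set.univ.pi I

/-- A finite collection of non-overlapping rectangles: no two of them share an interior point. -/
def IsNonOverlappingRectangles {ι : Type*} {k : ℕ} (S : Fin k → Set (ι → ℝ)) : Prop :=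
  (∀ i, IsRectangle (S i)) ∧
    Pairwise fun i j => Disjoint (interior (S i)) (interior (S j))

/-- For every `ε > 0` the set `R` contains a finite union of non-overlapping rectangles, and is
contained in another one, such that the differences have area less than `ε`. -/
def HasRectangleApproximation {ι : Type*} [Fintype ι] (R : Set (ι → ℝ)) : Prop :=
  ∀ ε : ℝ, 0 < ε →
    ∃ (k l : ℕ) (S : Fin k → Set (ι → ℝ)) (T : Fin l → Set (ι → ℝ)),
      IsNonOverlappingRectangles S ∧ IsNonOverlappingRectangles T ∧
      (⋃ i, S i) ⊆ R ∧ R ⊆ (⋃ j, T j) ∧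
      volume (R \ ⋃ i, S i) < ENNReal.ofReal ε ∧
      volume ((⋃ j, T j) \ R) < ENNReal.ofReal ε

/-- The point `(A/p, B/p)` of `[0,1]^(2n²)`, arranged as the `n × 2n` array `(A/p | B/p)`, where
residues are represented by integers in `{0, …, p-1}`. -/
noncomputable def matrixPairPoint {n p : ℕ} (A B : Matrix (Fin n) (Fin n) (ZMod p)) :
    Fin n × (Fin n ⊕ Fin n) → ℝ
  | (i, Sum.inl j) => ((A i j).val : ℝ) / (p : ℝ)
  | (i, Sum.inr j) => ((B i j).val : ℝ) / (p : ℝ)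

/-- The map sending `A ∈ GL_n(𝔽_p)` to the point `(A/p, B/p)`, where `B = C A⁻¹` is the
solution of `B A = C`. -/
noncomputable def matrixHyperbolaMap {n p : ℕ} (C A : Matrix.GeneralLinearGroup (Fin n) (ZMod p)) :
    Fin n × (Fin n ⊕ Fin n) → ℝ :=
  matrixPairPoint (A : Matrix (Fin n) (Fin n) (ZMod p))
    ((C * A⁻¹ : Matrix.GeneralLinearGroup (Fin n) (ZMod p)) : Matrix (Fin n) (Fin n) (ZMod p))

theorem range_matrixHyperbolaMap {n p : ℕ} (C : Matrix.GeneralLinearGroup (Fin n) (ZMod p)) :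
    Set.range (matrixHyperbolaMap C) =
      {x | ∃ A B : Matrix.GeneralLinearGroup (Fin n) (ZMod p), B * A = C ∧
        x = matrixPairPoint (A : Matrix (Fin n) (Fin n) (ZMod p))
          (B : Matrix (Fin n) (Fin n) (ZMod p))} := by
  ext x
  constructor
  · rintro ⟨A, rfl⟩
    exact ⟨A, C * A⁻¹, inv_mul_cancel_right C A, rfl⟩
  · rintro ⟨A, B, h, rfl⟩
    refine ⟨A, ?_⟩
    rw [matrixHyperbolaMap, ← h, mul_inv_cancel_right]

/-! The points `(A/p, B/p)` are viewed on the torus, where Weyl's criterion reduces equidistribution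
to showing that, for a fixed nonzero frequency, the sum over `GL_n(𝔽_p)` of `ψ(φ(A) + χ(CA⁻¹))` is
`o(#GL_n(𝔽_p))`. Here `φ`, `χ` are linear functionals, not both zero once `p` is large.

Replacing `A` by `tA` with `t` a nonzero scalar multiplies `φ(A)` by `t` and `χ(CA⁻¹)` by `t⁻¹`.
Averaging over `t` thus turns the matrix sum into an average of classical Kloosterman sums
(`norm_expSum_le_of_smul`). These are `O(p^(3/4))` by Kloosterman's fourth moment
(`norm_kloostermanSum_pow_four_le`) unless both arguments vanish, which happens for a proportion
`O(1/p)` of the `A`. Any power saving suffices, so Weil's bound is not needed, and the estimate is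
uniform in `C`.

To pass from weak convergence to counting in `R`, the rectangle hypothesis makes the frontier of `R`
null, and `rep` carries this to the torus, where the portmanteau theorem applies. -/

/-- The Kloosterman sum over `ℤ/p` attached to the standard additive character. -/
noncomputable def kloostermanSum {p : ℕ} [Fact p.Prime] (a b : ZMod p) : ℂ :=
  ∑ x : (ZMod p)ˣ, ZMod.stdAddChar (a * (x : ZMod p) + b * (x : ZMod p)⁻¹)

/-! ### Classical Kloosterman sums and their fourth moment. -/

section Kloosterman

variable {p : ℕ} [Fact p.Prime]

theorem norm_stdAddChar (a : ZMod p) : ‖ZMod.stdAddChar a‖ = 1 := by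
  rw [ZMod.stdAddChar_apply, Circle.norm_coe]

theorem conj_stdAddChar (a : ZMod p) :
    (starRingEnd ℂ) (ZMod.stdAddChar a) = ZMod.stdAddChar (-a) := by
  rw [AddChar.map_neg_eq_inv, Complex.inv_eq_conj (norm_stdAddChar a)]

theorem sum_stdAddChar_mul (t : ZMod p) :
    ∑ a : ZMod p, ZMod.stdAddChar (a * t) = if t = 0 then (p : ℂ) else 0 := by
  have := AddChar.sum_mulShift (R := ZMod p) t (ZMod.isPrimitive_stdAddChar p)
  simpa using this

/-- Parseval's identity for exponential sums with two frequencies. -/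
theorem sum_norm_sq_expSum {X : Type*} [Fintype X] (f g : X → ZMod p) :
    ∑ a : ZMod p, ∑ b : ZMod p, ‖∑ x, ZMod.stdAddChar (a * f x + b * g x)‖ ^ 2 =
      (p : ℝ) ^ 2 * (Finset.univ.filter fun z : X × X => f z.1 = f z.2 ∧ g z.1 = g z.2).card := by
  have key : ∀ a b : ZMod p,
      ((‖∑ x, ZMod.stdAddChar (a * f x + b * g x)‖ ^ 2 : ℝ) : ℂ) =
        ∑ z : X × X, ZMod.stdAddChar (a * (f z.1 - f z.2)) *
          ZMod.stdAddChar (b * (g z.1 - g z.2)) := by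
    intro a b
    push_cast
    rw [← Complex.mul_conj', map_sum, Finset.sum_mul_sum, ← Finset.univ_product_univ,
      Finset.sum_product]
    refine Finset.sum_congr rfl fun x _ => Finset.sum_congr rfl fun y _ => ?_
    rw [conj_stdAddChar, ← AddChar.map_add_eq_mul, ← AddChar.map_add_eq_mul]
    congr 1
    ring
  have : ((∑ a : ZMod p, ∑ b : ZMod p, ‖∑ x, ZMod.stdAddChar (a * f x + b * g x)‖ ^ 2 : ℝ) : ℂ) =
      (((p : ℝ) ^ 2 *
        (Finset.univ.filter fun z : X × X => f z.1 = f z.2 ∧ g z.1 = g z.2).card : ℝ) : ℂ) := by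
    rw [Complex.ofReal_sum]
    simp_rw [Complex.ofReal_sum, key]
    calc _ = ∑ z : X × X, (∑ a : ZMod p, ZMod.stdAddChar (a * (f z.1 - f z.2))) *
          ∑ b : ZMod p, ZMod.stdAddChar (b * (g z.1 - g z.2)) := by
          simp_rw [Finset.sum_mul_sum]
          rw [Finset.sum_comm (s := (Finset.univ : Finset (X × X)))]
          exact Finset.sum_congr rfl fun a _ => Finset.sum_comm
      _ = ∑ z : X × X, if f z.1 = f z.2 ∧ g z.1 = g z.2 then (p : ℂ) ^ 2 else 0 := by
          refine Finset.sum_congr rfl fun z _ => ?_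
          rw [sum_stdAddChar_mul, sum_stdAddChar_mul]
          simp only [sub_eq_zero]
          split_ifs <;> simp_all [sq]
      _ = _ := by
          rw [← Finset.sum_filter, Finset.sum_const, nsmul_eq_mul]
          push_cast
          ring
  exact_mod_cast this

theorem kloostermanSum_smul (a b : ZMod p) (t : (ZMod p)ˣ) :
    kloostermanSum (a * (t : ZMod p)) (b * (t : ZMod p)⁻¹) = kloostermanSum a b := by
  unfold kloostermanSum
  refine Fintype.sum_equiv (Equiv.mulLeft t) _ _ fun x => ?_
  simp only [Equiv.coe_mulLeft, mul_inv, Units.val_mul]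
  congr 1
  ring

theorem kloostermanSum_sq (a b : ZMod p) :
    kloostermanSum a b ^ 2 = ∑ z : (ZMod p)ˣ × (ZMod p)ˣ,
      ZMod.stdAddChar (a * ((z.1 : ZMod p) + (z.2 : ZMod p)) +
        b * ((z.1 : ZMod p)⁻¹ + (z.2 : ZMod p)⁻¹)) := by
  rw [sq, kloostermanSum, Finset.sum_mul_sum, ← Finset.univ_product_univ, Finset.sum_product]
  refine Finset.sum_congr rfl fun x _ => Finset.sum_congr rfl fun y _ => ?_
  rw [← AddChar.map_add_eq_mul]
  congr 1
  ring

/-- If the common sum is nonzero, equal inverse sums force equal products, so both pairs are the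
roots of one quadratic. A zero sum gives the third, degenerate family. -/
theorem eq_or_eq_of_add_eq_of_inv_add_eq {F : Type*} [Field F] {x y z w : F} (hx : x ≠ 0)
    (hy : y ≠ 0) (hz : z ≠ 0) (hw : w ≠ 0) (h : x + y = z + w)
    (h' : x⁻¹ + y⁻¹ = z⁻¹ + w⁻¹) : (z = x ∧ w = y) ∨ (z = y ∧ w = x) ∨ (y = -x ∧ w = -z) := by
  by_cases hs : x + y = 0
  · right; right
    exact ⟨by linear_combination hs, by linear_combination hs - h⟩
  · have h1 : z * w = x * y := by
      field_simp at h'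
      have : (x + y) * (z * w - x * y) = 0 := by
        linear_combination h' - x * y * h
      rcases mul_eq_zero.mp this with h | h
      · exact absurd h hs
      · linear_combination h
    have h2 : (z - x) * (z - y) = 0 := by
      linear_combination -z * h - h1
    rcases mul_eq_zero.mp h2 with h3 | h3
    · left
      have : z = x := by linear_combination h3
      exact ⟨this, by linear_combination -h - h3⟩
    · right; left
      exact ⟨by linear_combination h3, by linear_combination -h - h3⟩

/-- Each of the three families of solutions is parametrized by two units. -/
theorem card_kloosterman_energy_le :
    (Finset.univ.filter fun q : ((ZMod p)ˣ × (ZMod p)ˣ) × ((ZMod p)ˣ × (ZMod p)ˣ) =>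
      ((q.1.1 : ZMod p) + q.1.2 = (q.2.1 : ZMod p) + q.2.2) ∧
      (q.1.1 : ZMod p)⁻¹ + (q.1.2 : ZMod p)⁻¹ =
        (q.2.1 : ZMod p)⁻¹ + (q.2.2 : ZMod p)⁻¹).card ≤ 3 * (p - 1) ^ 2 := by
  classical
  let U := (ZMod p)ˣ
  let s₁ : Finset ((U × U) × (U × U)) := Finset.univ.image fun z : U × U => (z, z)
  let s₂ : Finset ((U × U) × (U × U)) := Finset.univ.image fun z : U × U => (z, (z.2, z.1))
  let s₃ : Finset ((U × U) × (U × U)) :=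
    Finset.univ.image fun z : U × U => ((z.1, -z.1), (z.2, -z.2))
  have hU : (Finset.univ : Finset (U × U)).card = (p - 1) ^ 2 := by
    rw [Finset.card_univ, Fintype.card_prod, ZMod.card_units, sq]
  have hsub : (Finset.univ.filter fun q : (U × U) × (U × U) =>
      ((q.1.1 : ZMod p) + q.1.2 = (q.2.1 : ZMod p) + q.2.2) ∧
      (q.1.1 : ZMod p)⁻¹ + (q.1.2 : ZMod p)⁻¹ =
        (q.2.1 : ZMod p)⁻¹ + (q.2.2 : ZMod p)⁻¹) ⊆ s₁ ∪ s₂ ∪ s₃ := by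
    rintro ⟨⟨x, y⟩, ⟨z, w⟩⟩ hq
    simp only [Finset.mem_filter, Finset.mem_univ, true_and] at hq
    simp only [Finset.mem_union, s₁, s₂, s₃, Finset.mem_image, Finset.mem_univ, true_and,
      Prod.mk.injEq, Prod.exists]
    rcases eq_or_eq_of_add_eq_of_inv_add_eq x.ne_zero y.ne_zero z.ne_zero w.ne_zero hq.1 hq.2 with
      ⟨h1, h2⟩ | ⟨h1, h2⟩ | ⟨h1, h2⟩
    · exact Or.inl (Or.inl ⟨x, y, ⟨rfl, rfl⟩, (Units.ext h1).symm, (Units.ext h2).symm⟩)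
    · exact Or.inl (Or.inr ⟨x, y, ⟨rfl, rfl⟩, (Units.ext h1).symm, (Units.ext h2).symm⟩)
    · exact Or.inr ⟨x, z, ⟨rfl, Units.ext (by rw [Units.val_neg, h1])⟩, rfl,
        Units.ext (by rw [Units.val_neg, h2])⟩
  calc _ ≤ (s₁ ∪ s₂ ∪ s₃).card := Finset.card_le_card hsub
    _ ≤ s₁.card + s₂.card + s₃.card :=
      (Finset.card_union_le _ _).trans (Nat.add_le_add_right (Finset.card_union_le _ _) _)
    _ ≤ (p - 1) ^ 2 + (p - 1) ^ 2 + (p - 1) ^ 2 := by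
      gcongr <;> exact Finset.card_image_le.trans hU.le
    _ = _ := by ring

/-- Kloosterman's elementary bound, by the fourth moment method. -/
theorem norm_kloostermanSum_pow_four_le {a b : ZMod p} (hab : a ≠ 0 ∨ b ≠ 0) :
    ‖kloostermanSum a b‖ ^ 4 ≤ 3 * (p : ℝ) ^ 3 := by
  have hp : (1 : ℝ) < p := by exact_mod_cast (Fact.out : p.Prime).one_lt
  have hcast : ((p - 1 : ℕ) : ℝ) = p - 1 := by
    rw [Nat.cast_sub (Fact.out : p.Prime).one_lt.le, Nat.cast_one]
  have hsum : ∑ q : ZMod p × ZMod p, ‖kloostermanSum q.1 q.2‖ ^ 4 ≤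
      (p : ℝ) ^ 2 * (3 * (p - 1) ^ 2) := by
    rw [← Finset.univ_product_univ, Finset.sum_product]
    have := sum_norm_sq_expSum (p := p)
      (fun z : (ZMod p)ˣ × (ZMod p)ˣ => (z.1 : ZMod p) + (z.2 : ZMod p))
      (fun z => (z.1 : ZMod p)⁻¹ + (z.2 : ZMod p)⁻¹)
    have h2 : ∀ z : ℂ, ‖z ^ 2‖ ^ 2 = ‖z‖ ^ 4 := fun z => by rw [norm_pow, ← pow_mul]
    simp only [← kloostermanSum_sq, h2] at this
    rw [this, ← hcast]
    gcongr
    exact_mod_cast card_kloosterman_energy_le (p := p)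
  have hinj : Function.Injective fun t : (ZMod p)ˣ =>
      ((a * t, b * (t : ZMod p)⁻¹) : ZMod p × ZMod p) := by
    intro t u h
    simp only [Prod.mk.injEq] at h
    rcases hab with ha | hb
    · exact Units.ext (mul_left_cancel₀ ha h.1)
    · exact Units.ext (inv_injective (mul_left_cancel₀ hb h.2))
  -- The `p - 1` frequencies `(at, bt⁻¹)` are distinct and share one Kloosterman sum, so its fourth
  -- power occurs `p - 1` times in the full moment.
  have horbit : (p - 1 : ℝ) * ‖kloostermanSum a b‖ ^ 4 ≤
      ∑ q : ZMod p × ZMod p, ‖kloostermanSum q.1 q.2‖ ^ 4 := by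
    calc (p - 1 : ℝ) * ‖kloostermanSum a b‖ ^ 4
        = ∑ t : (ZMod p)ˣ, ‖kloostermanSum (a * (t : ZMod p)) (b * (t : ZMod p)⁻¹)‖ ^ 4 := by
          simp_rw [kloostermanSum_smul]
          rw [Finset.sum_const, Finset.card_univ, ZMod.card_units, nsmul_eq_mul, hcast]
      _ = ∑ q ∈ Finset.univ.map ⟨_, hinj⟩, ‖kloostermanSum q.1 q.2‖ ^ 4 := by
          rw [Finset.sum_map]; rfl
      _ ≤ _ := Finset.sum_le_sum_of_subset_of_nonneg (Finset.subset_univ _)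
          fun _ _ _ => by positivity
  have h := horbit.trans hsum
  have h' : ‖kloostermanSum a b‖ ^ 4 ≤ 3 * (p : ℝ) ^ 2 * (p - 1) := by
    refine le_of_mul_le_mul_left (h.trans (le_of_eq ?_)) (sub_pos.mpr hp)
    ring
  nlinarith [sq_nonneg (p : ℝ)]

/-- If `(ℤ/p)ˣ` acts on `X` and scales `f` by `t` and `g` by `t⁻¹`, then the exponential sum of
`f + g` over `X` is small unless `f` and `g` vanish simultaneously too often. -/
theorem norm_expSum_le_of_smul {X : Type*} [Fintype X] [MulAction (ZMod p)ˣ X] (f g : X → ZMod p)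
    (hf : ∀ (t : (ZMod p)ˣ) x, f (t • x) = f x * t)
    (hg : ∀ (t : (ZMod p)ˣ) x, g (t • x) = g x * (t : ZMod p)⁻¹) :
    (p - 1 : ℝ) * ‖∑ x, ZMod.stdAddChar (f x + g x)‖ ≤
      (3 * (p : ℝ) ^ 3) ^ (1 / 4 : ℝ) * Fintype.card X +
        (p - 1) * (Finset.univ.filter fun x => f x = 0 ∧ g x = 0).card := by
  have hp : (1 : ℝ) < p := by exact_mod_cast (Fact.out : p.Prime).one_lt
  have hcast : ((p - 1 : ℕ) : ℝ) = p - 1 := by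
    rw [Nat.cast_sub (Fact.out : p.Prime).one_lt.le, Nat.cast_one]
  have havg : ((p - 1 : ℕ) : ℂ) * ∑ x, ZMod.stdAddChar (f x + g x) =
      ∑ x, kloostermanSum (f x) (g x) := by
    simp_rw [kloostermanSum]
    rw [Finset.sum_comm]
    have : ∀ t : (ZMod p)ˣ, ∑ x : X, ZMod.stdAddChar (f x * (t : ZMod p) + g x * (t : ZMod p)⁻¹) =
        ∑ x : X, ZMod.stdAddChar (f x + g x) := fun t =>
      Fintype.sum_equiv (MulAction.toPerm t) _ _ fun x => by
        rw [MulAction.toPerm_apply, hf, hg]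
    simp_rw [this]
    rw [Finset.sum_const, Finset.card_univ, ZMod.card_units, nsmul_eq_mul]
  have hbound : ∀ x, ‖kloostermanSum (f x) (g x)‖ ≤ (3 * (p : ℝ) ^ 3) ^ (1 / 4 : ℝ) +
      if f x = 0 ∧ g x = 0 then (p - 1 : ℝ) else 0 := by
    intro x
    split_ifs with h
    -- Both arguments vanish: only the trivial bound `p - 1` is available.
    · refine le_trans ?_ (le_add_of_nonneg_left (by positivity))
      refine (norm_sum_le _ _).trans ?_
      simp_rw [norm_stdAddChar]
      rw [Finset.sum_const, Finset.card_univ, ZMod.card_units, nsmul_eq_mul, hcast, mul_one]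
    · rw [add_zero]
      refine le_of_pow_le_pow_left₀ (n := 4) (by norm_num) (by positivity) ?_
      rw [← Real.rpow_natCast (_ ^ (1 / 4 : ℝ)), ← Real.rpow_mul (by positivity)]
      norm_num
      exact norm_kloostermanSum_pow_four_le (not_and_or.mp h)
  have hnorm : (p - 1 : ℝ) * ‖∑ x, ZMod.stdAddChar (f x + g x)‖ =
      ‖∑ x, kloostermanSum (f x) (g x)‖ := by
    rw [← havg, norm_mul, Complex.norm_natCast, hcast]
  rw [hnorm]
  refine (norm_sum_le _ _).trans ((Finset.sum_le_sum fun x _ => hbound x).trans (le_of_eq ?_))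
  rw [Finset.sum_add_distrib, Finset.sum_const, ← Finset.sum_filter, Finset.sum_const,
    Finset.card_univ, nsmul_eq_mul, nsmul_eq_mul]
  ring

end Kloosterman

/-! ### Exponential sums over `GL_n(𝔽_p)`. -/

section MatrixSums

variable {p : ℕ} [Fact p.Prime] {n : ℕ}

theorem card_mul_ker_of_ne_zero {M : Type*} [AddCommGroup M] [Module (ZMod p) M]
    {φ : M →ₗ[ZMod p] ZMod p} (hφ : φ ≠ 0) : Nat.card φ.ker * p = Nat.card M := by
  rw [Submodule.card_eq_card_quotient_mul_card φ.ker,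
    Nat.card_congr (φ.quotKerEquivOfSurjective (LinearMap.surjective hφ)).toEquiv, Nat.card_zmod]

/-- Each factor `p^n - p^i` of the order of `GL_n(𝔽_p)` is at least `p^n / 2`, since `i < n` and `p
≥ 2`. -/
theorem pow_sq_le_two_pow_mul_card_GL :
    p ^ (n * n) ≤ 2 ^ n * Fintype.card (Matrix.GeneralLinearGroup (Fin n) (ZMod p)) := by
  rw [← Nat.card_eq_fintype_card, Matrix.card_GL_field, ZMod.card, pow_mul]
  calc (p ^ n) ^ n = ∏ _i : Fin n, p ^ n := by simp
    _ ≤ ∏ i : Fin n, 2 * (p ^ n - p ^ (i : ℕ)) := by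
      refine Finset.prod_le_prod' fun i _ => ?_
      have h : 2 * p ^ (i : ℕ) ≤ p ^ n :=
        calc 2 * p ^ (i : ℕ) ≤ p * p ^ (i : ℕ) :=
              Nat.mul_le_mul_right _ (Fact.out : p.Prime).two_le
          _ = p ^ ((i : ℕ) + 1) := by ring
          _ ≤ p ^ n := Nat.pow_le_pow_right (Fact.out : p.Prime).pos i.2
      lia
    _ = _ := by rw [Finset.prod_mul_distrib]; simp

/-- The zeros inject through `e` into a hyperplane of `p^(n² - 1)` matrices. The map `e` will be the
identity for `φ` and `A ↦ CA⁻¹` for `χ`. -/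
theorem card_zeros_mul_le {φ : Matrix (Fin n) (Fin n) (ZMod p) →ₗ[ZMod p] ZMod p} (hφ : φ ≠ 0)
    {e : Matrix.GeneralLinearGroup (Fin n) (ZMod p) → Matrix.GeneralLinearGroup (Fin n) (ZMod p)}
    (he : Function.Injective e)
    {s : Finset (Matrix.GeneralLinearGroup (Fin n) (ZMod p))}
    (hs : ∀ A ∈ s, φ (e A : Matrix (Fin n) (Fin n) (ZMod p)) = 0) :
    s.card * p ≤ 2 ^ n * Fintype.card (Matrix.GeneralLinearGroup (Fin n) (ZMod p)) := by
  have hcard : s.card ≤ Nat.card φ.ker := by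
    classical
    rw [← Nat.card_eq_fintype_card (α := s) |>.trans (Fintype.card_coe s)]
    exact Nat.card_le_card_of_injective (fun A : s => (⟨_, hs A A.2⟩ : φ.ker)) fun A B hAB =>
      Subtype.ext (he (Units.ext (congrArg Subtype.val hAB)))
  calc s.card * p ≤ Nat.card φ.ker * p := Nat.mul_le_mul_right _ hcard
    _ = p ^ (n * n) := by
      rw [card_mul_ker_of_ne_zero hφ, Module.natCard_eq_pow_finrank (K := ZMod p),
        Module.finrank_matrix]
      simp
    _ ≤ _ := pow_sq_le_two_pow_mul_card_GL

/-- Nontrivial matrix Kloosterman sums over `GL_n(𝔽_p)` are small, uniformly in the frequencies. -/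
theorem norm_expSum_GL_le (C : Matrix.GeneralLinearGroup (Fin n) (ZMod p))
    (φ χ : Matrix (Fin n) (Fin n) (ZMod p) →ₗ[ZMod p] ZMod p) (h : φ ≠ 0 ∨ χ ≠ 0) :
    ‖∑ A : Matrix.GeneralLinearGroup (Fin n) (ZMod p), ZMod.stdAddChar
        (φ (A : Matrix (Fin n) (Fin n) (ZMod p)) +
          χ ((C * A⁻¹ : Matrix.GeneralLinearGroup (Fin n) (ZMod p)) :
            Matrix (Fin n) (Fin n) (ZMod p)))‖ ≤
      ((3 * (p : ℝ) ^ 3) ^ (1 / 4 : ℝ) / (p - 1) + 2 ^ n / p) *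
        Fintype.card (Matrix.GeneralLinearGroup (Fin n) (ZMod p)) := by
  have hp : (1 : ℝ) < p := by exact_mod_cast (Fact.out : p.Prime).one_lt
  have hp1 : (0 : ℝ) < p - 1 := sub_pos.mpr hp
  have key := norm_expSum_le_of_smul
    (fun A : Matrix.GeneralLinearGroup (Fin n) (ZMod p) =>
      φ (A : Matrix (Fin n) (Fin n) (ZMod p)))
    (fun A => χ ((C * A⁻¹ : Matrix.GeneralLinearGroup (Fin n) (ZMod p)) :
            Matrix (Fin n) (Fin n) (ZMod p)))
    (fun t A => by
      change φ ((t : ZMod p) • (A : Matrix (Fin n) (Fin n) (ZMod p))) = _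
      rw [map_smul, smul_eq_mul, mul_comm])
    (fun t A => by
      rw [Units.smul_inv, Units.val_mul, Units.val_mul, ← Units.val_inv_eq_inv_val]
      change χ ((C : Matrix (Fin n) (Fin n) (ZMod p)) *
        (((t⁻¹ : (ZMod p)ˣ) : ZMod p) • ((A⁻¹ : Matrix.GeneralLinearGroup (Fin n) (ZMod p)) :
          Matrix (Fin n) (Fin n) (ZMod p)))) = _
      rw [mul_smul_comm, map_smul, smul_eq_mul, mul_comm])
  have hz : ((Finset.univ.filter fun A : Matrix.GeneralLinearGroup (Fin n) (ZMod p) =>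
      φ (A : Matrix (Fin n) (Fin n) (ZMod p)) = 0 ∧
        χ ((C * A⁻¹ : Matrix.GeneralLinearGroup (Fin n) (ZMod p)) :
            Matrix (Fin n) (Fin n) (ZMod p)) = 0).card : ℝ) * p ≤
      2 ^ n * Fintype.card (Matrix.GeneralLinearGroup (Fin n) (ZMod p)) := by
    refine mod_cast ?_
    rcases h with h | h
    · exact card_zeros_mul_le h (e := id) Function.injective_id
        fun A hA => (Finset.mem_filter.mp hA).2.1
    · exact card_zeros_mul_le h (e := fun A => C * A⁻¹)
        ((mul_right_injective C).comp inv_injective)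
        fun A hA => (Finset.mem_filter.mp hA).2.2
  refine le_of_mul_le_mul_left (key.trans ?_) hp1
  rw [← le_div_iff₀ (by positivity)] at hz
  calc _ ≤ (3 * (p : ℝ) ^ 3) ^ (1 / 4 : ℝ) *
          Fintype.card (Matrix.GeneralLinearGroup (Fin n) (ZMod p)) + (p - 1) *
          (2 ^ n * Fintype.card (Matrix.GeneralLinearGroup (Fin n) (ZMod p)) / p) := by gcongr
    _ = _ := by field_simp

end MatrixSums

theorem tendsto_kloosterman_error (n : ℕ) :
    Tendsto (fun p : ℕ => (3 * (p : ℝ) ^ 3) ^ (1 / 4 : ℝ) / (p - 1) + 2 ^ n / p) atTop (𝓝 0) := by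
  have h1 : Tendsto (fun p : ℕ => (2 : ℝ) ^ n / p) atTop (𝓝 0) :=
    tendsto_const_div_atTop_nhds_zero_nat _
  -- The factor 2 pays for `p ≤ 2(p - 1)`.
  have h2 : Tendsto (fun p : ℕ => 2 * (3 : ℝ) ^ (1 / 4 : ℝ) * (p : ℝ) ^ (-(1 / 4) : ℝ)) atTop
      (𝓝 0) := by
    simpa using ((tendsto_rpow_neg_atTop (y := 1 / 4) (by norm_num)).comp
      tendsto_natCast_atTop_atTop).const_mul (2 * (3 : ℝ) ^ (1 / 4 : ℝ))
  have h3 : Tendsto (fun p : ℕ => (3 * (p : ℝ) ^ 3) ^ (1 / 4 : ℝ) / (p - 1)) atTop (𝓝 0) := by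
    refine squeeze_zero' ?_ ?_ h2
    · filter_upwards [eventually_ge_atTop 2] with p hp
      have : (2 : ℝ) ≤ p := by exact_mod_cast hp
      have : (0 : ℝ) < p - 1 := by linarith
      positivity
    · filter_upwards [eventually_ge_atTop 2] with p hp
      have hp2 : (2 : ℝ) ≤ p := by exact_mod_cast hp
      have hp0 : (0 : ℝ) < p := by linarith
      have hp1 : (0 : ℝ) < p - 1 := by linarith
      rw [div_le_iff₀ hp1, Real.mul_rpow (by norm_num) (by positivity),
        ← Real.rpow_natCast (p : ℝ) 3, ← Real.rpow_mul hp0.le]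
      have e : (p : ℝ) ^ (((3 : ℕ) : ℝ) * (1 / 4)) = (p : ℝ) ^ (-(1 / 4) : ℝ) * p := by
        rw [← Real.rpow_add_one hp0.ne']
        norm_num
      rw [e]
      have : (p : ℝ) ≤ 2 * (p - 1) := by linarith
      calc (3 : ℝ) ^ (1 / 4 : ℝ) * ((p : ℝ) ^ (-(1 / 4) : ℝ) * p)
          ≤ (3 : ℝ) ^ (1 / 4 : ℝ) * ((p : ℝ) ^ (-(1 / 4) : ℝ) * (2 * (p - 1))) := by gcongr
        _ = _ := by ring
  simpa using h3.add h1

/-! ### Empirical measures. -/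

/-- The uniform probability measure on the values of a function on a nonempty finite type. -/
noncomputable def empiricalMeasure {α X : Type*} [Fintype α] [Nonempty α] [MeasurableSpace X]
    (f : α → X) : ProbabilityMeasure X :=
  ⟨(Fintype.card α : ENNReal)⁻¹ • ∑ a, Measure.dirac (f a), ⟨by
    simp [ENNReal.inv_mul_cancel]⟩⟩

section Empirical

variable {α X : Type*} [Fintype α] [Nonempty α] [MeasurableSpace X] [MeasurableSingletonClass X]

theorem integral_empiricalMeasure (f : α → X) (g : X → ℂ) :
    ∫ x, g x ∂(empiricalMeasure f : Measure X) = (Fintype.card α : ℂ)⁻¹ * ∑ a, g (f a) := by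
  change ∫ x, g x ∂((Fintype.card α : ENNReal)⁻¹ • ∑ a, Measure.dirac (f a)) = _
  rw [integral_smul_measure, integral_finsetSum_measure fun _ _ => integrable_dirac (by simp)]
  simp [Complex.real_smul]

theorem empiricalMeasure_apply (f : α → X) (s : Set X) :
    (empiricalMeasure f : Measure X).real s = (Nat.card {a // f a ∈ s} : ℝ) / Nat.card α := by
  classical
  change ((Fintype.card α : ENNReal)⁻¹ • ∑ a, Measure.dirac (f a)).real s = _
  rw [measureReal_def, Measure.smul_apply, Measure.finsetSum_apply]
  simp only [Measure.dirac_apply, Set.indicator_apply, Pi.one_apply, Finset.sum_boole,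
    Nat.card_eq_fintype_card, Fintype.card_subtype]
  simp [div_eq_inv_mul]

end Empirical

/-! ### Weyl's criterion on the torus. -/

namespace UnitAddTorus

variable {d : Type*} [Fintype d]

instance isProbabilityMeasure_volume : IsProbabilityMeasure (volume : Measure (UnitAddTorus d)) :=
  ⟨by
    rw [volume_pi, Measure.pi_univ]
    simp [AddCircle.measure_univ]⟩

/-- Translation by half a period of a nontrivial factor changes its sign, so that factor integrates
to zero. -/
theorem integral_mFourier_of_ne_zero {k : d → ℤ} (hk : k ≠ 0) :
    ∫ x : UnitAddTorus d, mFourier k x = 0 := by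
  obtain ⟨i, hi⟩ := Function.ne_iff.mp hk
  have h : ∫ x : AddCircle (1 : ℝ), fourier (k i) x = 0 :=
    integral_eq_zero_of_add_right_eq_neg (fourier_add_half_inv_index hi (by norm_num))
  change ∫ x : d → AddCircle (1 : ℝ), ∏ i, fourier (k i) (x i) = 0
  rw [volume_pi, integral_fintype_prod_eq_prod (fun i x => (fourier (k i) x : ℂ))]
  exact Finset.prod_eq_zero (Finset.mem_univ i) h

/-- **Weyl's criterion** on the torus, for a family of probability measures. -/
theorem tendsto_probabilityMeasure_of_mFourier {ι : Type*} {L : Filter ι}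
    {μ : ι → ProbabilityMeasure (UnitAddTorus d)} {ν : ProbabilityMeasure (UnitAddTorus d)}
    (h : ∀ k : d → ℤ, Tendsto (fun i => ∫ x, mFourier k x ∂(μ i : Measure (UnitAddTorus d))) L
      (𝓝 (∫ x, mFourier k x ∂(ν : Measure (UnitAddTorus d))))) :
    Tendsto μ L (𝓝 ν) := by
  have hint : ∀ (m : ProbabilityMeasure (UnitAddTorus d)) (f : C(UnitAddTorus d, ℂ)),
      Integrable f (m : Measure (UnitAddTorus d)) := fun m f =>
    (BoundedContinuousFunction.mkOfCompact f).integrable _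
  -- The test functions with convergent integrals form a subspace containing all characters, whose
  -- span is dense; `hdist`, uniform in the measure, allows a three-epsilon argument.
  let S : Submodule ℂ C(UnitAddTorus d, ℂ) :=
    { carrier := {f | Tendsto (fun i => ∫ x, f x ∂(μ i : Measure (UnitAddTorus d))) L
        (𝓝 (∫ x, f x ∂(ν : Measure (UnitAddTorus d))))}
      add_mem' := fun {f g} hf hg => by
        simp only [Set.mem_ofPred_eq, ContinuousMap.add_apply] at hf hg ⊢
        simp_rw [integral_add (hint _ f) (hint _ g)]
        exact hf.add hg
      zero_mem' := by simp [tendsto_const_nhds]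
      smul_mem' := fun c f hf => by
        simp only [Set.mem_ofPred_eq, ContinuousMap.smul_apply] at hf ⊢
        simp_rw [integral_smul]
        exact hf.const_smul c }
  have hspan : Submodule.span ℂ (Set.range (mFourier (d := d))) ≤ S := by
    rw [Submodule.span_le]
    rintro _ ⟨k, rfl⟩
    exact h k
  have hdist : ∀ (m : ProbabilityMeasure (UnitAddTorus d)) (f g : C(UnitAddTorus d, ℂ)),
      dist (∫ x, f x ∂(m : Measure (UnitAddTorus d))) (∫ x, g x ∂(m : Measure (UnitAddTorus d))) ≤
        dist f g := by
    intro m f g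
    rw [dist_eq_norm, ← integral_sub (hint m f) (hint m g)]
    refine (norm_integral_le_of_norm_le_const (C := dist f g) (ae_of_all _ fun x => ?_)).trans
      (by simp)
    rw [← dist_eq_norm]
    exact ContinuousMap.dist_apply_le_dist x
  rw [ProbabilityMeasure.tendsto_iff_forall_integral_rclike_tendsto ℂ]
  intro f
  rw [Metric.tendsto_nhds]
  intro ε hε
  have hmem : f.toContinuousMap ∈
      (Submodule.span ℂ (Set.range (mFourier (d := d)))).topologicalClosure := by
    rw [span_mFourier_closure_eq_top]; trivial
  obtain ⟨g, hg, hfg⟩ := Metric.mem_closure_iff.mp hmem (ε / 3) (by positivity)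
  filter_upwards [Metric.tendsto_nhds.mp (hspan hg) (ε / 3) (by positivity)] with i hi
  have h1 := hdist (μ i) f.toContinuousMap g
  have h2 := hdist ν g f.toContinuousMap
  rw [dist_comm g] at h2
  have h3 := dist_triangle4 (∫ x, f x ∂(μ i : Measure (UnitAddTorus d)))
    (∫ x, g x ∂(μ i : Measure (UnitAddTorus d))) (∫ x, g x ∂(ν : Measure (UnitAddTorus d)))
    (∫ x, f x ∂(ν : Measure (UnitAddTorus d)))
  simp only [BoundedContinuousFunction.coe_toContinuousMap] at h1 h2
  linarith

end UnitAddTorus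

/-! ### Null frontier from rectangle approximation. -/

section Frontier

variable {ι : Type*} [Fintype ι]

theorem IsRectangle.volume_frontier {S : Set (ι → ℝ)} (hS : IsRectangle S) :
    volume (frontier S) = 0 := by
  obtain ⟨I, hI, rfl⟩ := hS
  exact Convex.addHaar_frontier volume (convex_pi fun i _ => (hI i).1.convex)

/-- A set with rectangle approximations has null frontier, that is, it is Jordan measurable. -/
theorem HasRectangleApproximation.volume_frontier {R : Set (ι → ℝ)}
    (hR : HasRectangleApproximation R) : volume (frontier R) = 0 := by
  refine le_antisymm (ENNReal.le_of_forall_pos_le_add fun ε hε _ => ?_) zero_le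
  obtain ⟨k, l, S, T, hS, hT, hSR, hRT, h1, h2⟩ := hR (ε / 2) (by positivity)
  -- Away from the frontiers of the boxes, a frontier point of `R` lies in an outer box (a finite
  -- union of closures is closed) and in no inner box (it would be interior to `R`), hence in one of
  -- the two small differences.
  have hsub : frontier R ⊆ ((⋃ j, frontier (T j)) ∪ ⋃ i, frontier (S i)) ∪
      ((R \ ⋃ i, S i) ∪ ((⋃ j, T j) \ R)) := by
    rintro x ⟨hxc, hxi⟩
    by_cases hfT : x ∈ ⋃ j, frontier (T j)
    · exact Or.inl (Or.inl hfT)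
    by_cases hfS : x ∈ ⋃ i, frontier (S i)
    · exact Or.inl (Or.inr hfS)
    right
    have hxT : x ∈ ⋃ j, T j := by
      have := closure_mono hRT hxc
      rw [closure_iUnion_of_finite] at this
      obtain ⟨j, hj⟩ := Set.mem_iUnion.mp this
      by_contra hn
      exact hfT (Set.mem_iUnion.mpr ⟨j, hj, fun hi =>
        hn (Set.mem_iUnion.mpr ⟨j, interior_subset hi⟩)⟩)
    have hxS : x ∉ ⋃ i, S i := by
      intro hx
      obtain ⟨i, hi⟩ := Set.mem_iUnion.mp hx
      exact hfS (Set.mem_iUnion.mpr ⟨i, subset_closure hi, fun hi' =>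
        hxi (interior_mono ((Set.subset_iUnion S i).trans hSR) hi')⟩)
    by_cases hx : x ∈ R
    · exact Or.inl ⟨hx, hxS⟩
    · exact Or.inr ⟨hxT, hx⟩
  have hT0 : volume (⋃ j, frontier (T j)) = 0 :=
    measure_iUnion_null fun j => (hT.1 j).volume_frontier
  have hS0 : volume (⋃ i, frontier (S i)) = 0 :=
    measure_iUnion_null fun i => (hS.1 i).volume_frontier
  calc volume (frontier R) ≤ _ := measure_mono hsub
    _ ≤ volume ((⋃ j, frontier (T j)) ∪ ⋃ i, frontier (S i)) +
        (volume (R \ ⋃ i, S i) + volume ((⋃ j, T j) \ R)) :=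
      (measure_union_le _ _).trans (add_le_add_right (measure_union_le _ _) _)
    _ ≤ 0 + (ENNReal.ofReal (ε / 2) + ENNReal.ofReal (ε / 2)) := by
      gcongr
      exact (measure_union_null hT0 hS0).le
    _ = 0 + ε := by
      rw [← ENNReal.ofReal_add (by positivity) (by positivity), add_halves,
        ENNReal.ofReal_coe_nnreal]

end Frontier

/-! ### Transfer between the torus and the unit cube. -/

namespace UnitAddTorus

variable {d : Type*}

/-- The representative in `[0,1)^d` of a point of the torus. -/
noncomputable def rep (x : UnitAddTorus d) : d → ℝ := fun i => (AddCircle.equivIco 1 0 (x i) : ℝ)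

theorem rep_coe {y : d → ℝ} (hy : ∀ i, y i ∈ Set.Ico (0 : ℝ) 1) :
    rep (fun i => (y i : UnitAddCircle)) = y := by
  funext i
  exact AddCircle.equivIco_coe_of_mem (by simpa using hy i)

theorem continuousAt_rep {x : UnitAddTorus d} (hx : ∀ i, x i ≠ 0) : ContinuousAt rep x := by
  refine continuousAt_pi.mpr fun i => ?_
  have h : ContinuousAt (AddCircle.equivIco (1 : ℝ) 0) (x i) :=
    AddCircle.continuousAt_equivIco 1 0 (by simpa using hx i)
  exact continuousAt_subtype_val.comp
    (ContinuousAt.comp (f := fun y : UnitAddTorus d => y i) h (continuous_apply i).continuousAt)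

theorem measurePreserving_equivIco :
    MeasurePreserving (fun x : UnitAddCircle => (AddCircle.equivIco 1 0 x : ℝ)) volume
      (volume.restrict (Set.Ico 0 1)) := by
  have hmeas : Measurable (fun x : UnitAddCircle => (AddCircle.equivIco 1 0 x : ℝ)) :=
    measurable_subtype_coe.comp (AddCircle.measurableEquivIco 1 0).measurable
  refine ⟨hmeas, ?_⟩
  have hmk := AddCircle.measurePreserving_mk (1 : ℝ) 0
  rw [zero_add, ← Measure.restrict_congr_set Ico_ae_eq_Ioc] at hmk
  rw [← hmk.map_eq, Measure.map_map hmeas hmk.measurable]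
  conv_rhs => rw [← Measure.map_id (μ := volume.restrict (Set.Ico (0 : ℝ) 1))]
  refine Measure.map_congr ((ae_restrict_iff' measurableSet_Ico).mpr (ae_of_all _ fun x hx => ?_))
  exact AddCircle.equivIco_coe_of_mem (by simpa using hx)

variable [Fintype d]

theorem measurePreserving_rep :
    MeasurePreserving (rep (d := d)) volume (volume.restrict (Set.Icc 0 1)) := by
  have h := measurePreserving_pi (fun _ : d => (volume : Measure UnitAddCircle))
    (fun _ => volume.restrict (Set.Ico (0 : ℝ) 1)) fun _ => measurePreserving_equivIco
  rw [← Measure.restrict_pi_pi] at h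
  have e : (Set.univ.pi fun _ : d => Set.Ico (0 : ℝ) 1) =ᵐ[Measure.pi fun _ => volume]
      (Set.Icc 0 1 : Set (d → ℝ)) := Measure.univ_pi_Ico_ae_eq_Icc
  rw [Measure.restrict_congr_set e] at h
  exact h

theorem volume_preimage_rep_eq_zero {F : Set (d → ℝ)} (hF : volume F = 0) :
    volume (rep ⁻¹' F) = 0 :=
  measurePreserving_rep.quasiMeasurePreserving.preimage_null
    (Measure.restrict_le_self.absolutelyContinuous hF)

/-- `rep` is continuous wherever no coordinate is zero, so new frontier points can only come from
coordinate hyperplanes, which are null. -/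
theorem volume_frontier_preimage_rep {R : Set (d → ℝ)} (hR : volume (frontier R) = 0) :
    volume (frontier (rep ⁻¹' R)) = 0 := by
  have hsub : frontier (rep ⁻¹' R) ⊆ rep ⁻¹' (frontier R ∪ ⋃ i : d, {y | y i = 0}) := by
    intro x hx
    by_cases h0 : ∀ i, x i ≠ 0
    · left
      have hc := continuousAt_rep h0
      refine ⟨?_, fun hi => hx.2 ?_⟩
      · exact closure_mono (Set.image_preimage_subset _ _) (mem_closure_image hc hx.1)
      · exact mem_interior_iff_mem_nhds.mpr (hc (mem_interior_iff_mem_nhds.mp hi))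
    · right
      push Not at h0
      obtain ⟨i, hi⟩ := h0
      refine Set.mem_iUnion.mpr ⟨i, ?_⟩
      have : (AddCircle.equivIco (1 : ℝ) 0 ((0 : ℝ) : UnitAddCircle) : ℝ) = 0 :=
        AddCircle.equivIco_coe_of_mem (by simp)
      simpa [rep, hi] using this
  refine measure_mono_null hsub (volume_preimage_rep_eq_zero (measure_union_null hR
    (measure_iUnion_null fun i => ?_)))
  exact Measure.pi_hyperplane _ i 0

theorem volume_preimage_rep {R : Set (d → ℝ)} (hR : R ⊆ Set.Icc 0 1)
    (hm : NullMeasurableSet R volume) : volume (rep ⁻¹' R) = volume R := by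
  rw [measurePreserving_rep.measure_preimage (hm.mono Measure.restrict_le_self),
    Measure.restrict_eq_self _ hR]

end UnitAddTorus

/-! ### Fourier coefficients and counting for the matrix hyperbola. -/

/-- The pair `(A, B)` as an `n × 2n` array. -/
def matrixPairEntry {n p : ℕ} (A B : Matrix (Fin n) (Fin n) (ZMod p)) :
    Fin n × (Fin n ⊕ Fin n) → ZMod p
  | (i, Sum.inl j) => A i j
  | (i, Sum.inr j) => B i j

section Points

variable {n p : ℕ}

theorem matrixPairPoint_eq (A B : Matrix (Fin n) (Fin n) (ZMod p)) (q : Fin n × (Fin n ⊕ Fin n)) :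
    matrixPairPoint A B q = ((matrixPairEntry A B q).val : ℝ) / p := by
  rcases q with ⟨i, j | j⟩ <;> rfl

variable [Fact p.Prime]

theorem matrixPairPoint_mem_Ico (A B : Matrix (Fin n) (Fin n) (ZMod p))
    (q : Fin n × (Fin n ⊕ Fin n)) : matrixPairPoint A B q ∈ Set.Ico (0 : ℝ) 1 := by
  have hp : (0 : ℝ) < p := by exact_mod_cast (Fact.out : p.Prime).pos
  rw [matrixPairPoint_eq]
  refine ⟨by positivity, (div_lt_one hp).mpr ?_⟩
  exact_mod_cast ZMod.val_lt _

/-- Makes counting points of the image the same as counting matrices `A`. -/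
theorem matrixHyperbolaMap_injective (C : Matrix.GeneralLinearGroup (Fin n) (ZMod p)) :
    Function.Injective (matrixHyperbolaMap C) := by
  have hp : (p : ℝ) ≠ 0 := by exact_mod_cast (Fact.out : p.Prime).ne_zero
  intro A A' h
  refine Units.ext (Matrix.ext fun i j => ZMod.val_injective p ?_)
  have := congrFun h (i, Sum.inl j)
  simp only [matrixHyperbolaMap, matrixPairPoint] at this
  exact_mod_cast (div_left_inj' hp).mp this

theorem fourier_val_div (k : ℤ) (v : ZMod p) :
    fourier k (((v.val : ℝ) / p : ℝ) : UnitAddCircle) = ZMod.stdAddChar ((k : ZMod p) * v) := by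
  have : (k : ZMod p) * v = ((k * v.val : ℤ) : ZMod p) := by simp
  rw [this, ZMod.stdAddChar_coe, fourier_coe_apply]
  congr 1
  push_cast
  ring

theorem mFourier_matrixPairPoint (k : Fin n × (Fin n ⊕ Fin n) → ℤ)
    (A B : Matrix (Fin n) (Fin n) (ZMod p)) :
    UnitAddTorus.mFourier k (fun q => (matrixPairPoint A B q : UnitAddCircle)) =
      ZMod.stdAddChar (∑ q, (k q : ZMod p) * matrixPairEntry A B q) := by
  change ∏ q, fourier (k q) (matrixPairPoint A B q : UnitAddCircle) = _
  simp_rw [matrixPairPoint_eq, fourier_val_div]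
  have h := map_sum (ZMod.stdAddChar (N := p)).toAddMonoidHom
    (fun q => (k q : ZMod p) * matrixPairEntry A B q) Finset.univ
  exact (congrArg Additive.toMul h).symm

/-- The linear functional `A ↦ ∑ u i j * A i j` on matrices. -/
noncomputable def entryFunctional (u : Fin n → Fin n → ZMod p) :
    Matrix (Fin n) (Fin n) (ZMod p) →ₗ[ZMod p] ZMod p :=
  ∑ i, ∑ j, u i j • Matrix.entryLinearMap (ZMod p) (ZMod p) i j

theorem entryFunctional_apply (u : Fin n → Fin n → ZMod p) (A : Matrix (Fin n) (Fin n) (ZMod p)) :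
    entryFunctional u A = ∑ i, ∑ j, u i j * A i j := by
  simp [entryFunctional]

theorem entryFunctional_ne_zero {u : Fin n → Fin n → ZMod p} {i j : Fin n} (h : u i j ≠ 0) :
    entryFunctional u ≠ 0 := by
  intro h0
  have := LinearMap.congr_fun h0 (Matrix.single i j 1)
  rw [entryFunctional_apply, Finset.sum_eq_single i, Finset.sum_eq_single j] at this
  · simp [h] at this
  · intro b _ hb; simp [hb.symm]
  · simp
  · intro b _ hb; simp [hb.symm]
  · simp

theorem sum_mul_matrixPairEntry (k : Fin n × (Fin n ⊕ Fin n) → ZMod p)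
    (A B : Matrix (Fin n) (Fin n) (ZMod p)) :
    ∑ q, k q * matrixPairEntry A B q =
      entryFunctional (fun i j => k (i, Sum.inl j)) A +
        entryFunctional (fun i j => k (i, Sum.inr j)) B := by
  rw [Fintype.sum_prod_type]
  simp [Fintype.sum_sum_type, Finset.sum_add_distrib, entryFunctional_apply, matrixPairEntry]

/-- The uniform measure on the image of the matrix hyperbola in the torus. -/
noncomputable def hyperbolaMeasure (C : Matrix.GeneralLinearGroup (Fin n) (ZMod p)) :
    ProbabilityMeasure (UnitAddTorus (Fin n × (Fin n ⊕ Fin n))) :=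
  empiricalMeasure fun A q => (matrixHyperbolaMap C A q : UnitAddCircle)

theorem norm_integral_mFourier_hyperbolaMeasure_le
    (C : Matrix.GeneralLinearGroup (Fin n) (ZMod p)) {k : Fin n × (Fin n ⊕ Fin n) → ℤ}
    (hk : ∃ q, (k q : ZMod p) ≠ 0) :
    ‖∫ x, UnitAddTorus.mFourier k x ∂(hyperbolaMeasure C : Measure (UnitAddTorus _))‖ ≤
      (3 * (p : ℝ) ^ 3) ^ (1 / 4 : ℝ) / (p - 1) + 2 ^ n / p := by
  have hN : (0 : ℝ) < Fintype.card (Matrix.GeneralLinearGroup (Fin n) (ZMod p)) := by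
    exact_mod_cast Fintype.card_pos
  rw [hyperbolaMeasure, integral_empiricalMeasure, norm_mul, norm_inv, Complex.norm_natCast,
    inv_mul_le_iff₀ hN, mul_comm]
  simp_rw [matrixHyperbolaMap, mFourier_matrixPairPoint,
    sum_mul_matrixPairEntry (fun q => (k q : ZMod p))]
  refine norm_expSum_GL_le C _ _ ?_
  obtain ⟨⟨i, j | j⟩, h⟩ := hk
  · exact Or.inl (entryFunctional_ne_zero (i := i) (j := j) h)
  · exact Or.inr (entryFunctional_ne_zero (i := i) (j := j) h)

theorem hyperbolaMeasure_real_preimage_rep (C : Matrix.GeneralLinearGroup (Fin n) (ZMod p))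
    (R : Set (Fin n × (Fin n ⊕ Fin n) → ℝ)) :
    (hyperbolaMeasure C : Measure (UnitAddTorus _)).real (UnitAddTorus.rep ⁻¹' R) =
      ((Set.range (matrixHyperbolaMap C) ∩ R).ncard : ℝ) /
        Nat.card (Matrix.GeneralLinearGroup (Fin n) (ZMod p)) := by
  rw [hyperbolaMeasure, empiricalMeasure_apply, ← Set.image_preimage_eq_range_inter,
    Set.ncard_image_of_injective _ (matrixHyperbolaMap_injective C)]
  simp_rw [Set.mem_preimage]
  have : ∀ A, UnitAddTorus.rep (fun q => (matrixHyperbolaMap C A q : UnitAddCircle)) =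
      matrixHyperbolaMap C A := fun A => UnitAddTorus.rep_coe (matrixPairPoint_mem_Ico _ _)
  simp_rw [this]
  rfl

end Points

/-! ### Equidistribution and the limit formula. -/

/-- The matrix hyperbolas equidistribute on the torus as `p → ∞`. -/
theorem tendsto_hyperbolaMeasure {n : ℕ}
    (C : (p : Nat.Primes) → Matrix.GeneralLinearGroup (Fin n) (ZMod p)) :
    Tendsto (fun p : Nat.Primes => haveI := Fact.mk p.2; hyperbolaMeasure (C p))
      (comap Subtype.val atTop) (𝓝 ⟨volume, inferInstance⟩) := by
  refine UnitAddTorus.tendsto_probabilityMeasure_of_mFourier fun k => ?_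
  by_cases hk : k = 0
  · subst hk
    simp [UnitAddTorus.mFourier_zero, tendsto_const_nhds]
  · change Tendsto _ _ (𝓝 (∫ x, UnitAddTorus.mFourier k x))
    rw [UnitAddTorus.integral_mFourier_of_ne_zero hk]
    obtain ⟨q, hq⟩ := Function.ne_iff.mp hk
    refine squeeze_zero_norm' ?_ ((tendsto_kloosterman_error n).comp tendsto_comap)
    -- The frequency is fixed, so its nonzero coordinate stays nonzero modulo every prime exceeding
    -- its absolute value.
    filter_upwards [tendsto_comap.eventually (eventually_gt_atTop (k q).natAbs)] with p hp
    have := Fact.mk p.2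
    refine norm_integral_mFourier_hyperbolaMeasure_le (C p) ⟨q, fun h => ?_⟩
    rw [ZMod.intCast_zmod_eq_zero_iff_dvd] at h
    exact hq (Int.eq_zero_of_abs_lt_dvd h (by rw [Int.abs_eq_natAbs]; exact_mod_cast hp))

theorem mainTheorem2 (n : ℕ) (hn : 1 ≤ n)
    (R : Set (Fin n × (Fin n ⊕ Fin n) → ℝ))
    (hRcube : R ⊆ Set.Icc 0 1)
    (hRmeas : NullMeasurableSet R volume)
    (hR : HasRectangleApproximation R)
    (C : (p : ℕ) → Matrix.GeneralLinearGroup (Fin n) (ZMod p)) :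
    Tendsto
      (fun p : ℕ =>
        ((Set.range (matrixHyperbolaMap (C p)) ∩ R).ncard : ℝ) /
          (Nat.card (Matrix.GeneralLinearGroup (Fin n) (ZMod p)) : ℝ))
      (atTop ⊓ 𝓟 {p : ℕ | p.Prime})
      (𝓝 (volume.real R)) := by
  -- Indexing by `Nat.Primes` makes primality available at every index, as the measures require.
  have hf : (atTop ⊓ 𝓟 {p : ℕ | p.Prime} : Filter ℕ) =
      map (Subtype.val : Nat.Primes → ℕ) (comap Subtype.val atTop) := by
    rw [Filter.map_comap]
    exact congrArg (fun s => atTop ⊓ 𝓟 s) Subtype.range_coe_subtype.symm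
  rw [hf, tendsto_map'_iff]
  have h := ProbabilityMeasure.tendsto_measure_of_null_frontier_of_tendsto'
    (tendsto_hyperbolaMeasure fun p : Nat.Primes => C p)
    (E := UnitAddTorus.rep ⁻¹' R) (UnitAddTorus.volume_frontier_preimage_rep hR.volume_frontier)
  have h' := (ENNReal.tendsto_toReal
    (measure_ne_top (volume : Measure (UnitAddTorus (Fin n × (Fin n ⊕ Fin n)))) _)).comp h
  have hvol : (volume (UnitAddTorus.rep ⁻¹' R)).toReal = volume.real R := by
    rw [UnitAddTorus.volume_preimage_rep hRcube hRmeas, measureReal_def]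
  rw [← hvol]
  refine h'.congr fun p => ?_
  have := Fact.mk p.2
  exact hyperbolaMeasure_real_preimage_rep (C p) R
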